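/- Let $n\ge 2$ and $k\ge 0$ be integers, write $\mathbf R^{n+1}_0=\mathbf R^{n+1}\setminus\{0\}$, and let $S$ be a spinor module of $\mathbf R^{n+1}$, i.e. a finite-dimensional irreducible complex module over the Clifford algebra of $\mathbf R^{n+1}$ with $v\cdot v=-\|v\|^2$. Let $e_1,\dots,e_{n+1}$ be the standard basis, $x=\sum_i x_ie_i$, and let $D\sigma=\sum_i e_i\cdot\partial_i\sigma$ be the Dirac operator on $S$-valued functions. An $S$-valued one-form $\psi=\sum_i\psi_i\otimes dx^i$ on $\mathbf R^{n+1}_0$ is a section of $S_{3/2}$ if it is smooth and $\mu(\psi):=\sum_i e_i\cdot\psi_i=0$; it is a solution of the Rarita–Schwinger equation if moreover $$\mathcal R\psi=\sum_i\Big(D\psi_i+\tfrac1{n+1}\,e_i\cdot\sum_l e_l\cdot D\psi_l\Big)\otimes dx^i=0 .$$ Let $\mathcal P_k(1)$ be the space of solutions of the Rarita–Schwinger equation on $\mathbf R^{n+1}_0$ that are polynomial and homogeneous of degree $k$, and $\mathcal P_j(0)$ the space of $S$-valued solutions of the Dirac equation on $\mathbf R^{n+1}_0$ that are polynomial and homogeneous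 of degree $j$ (so $\mathcal P_{-1}(0)=0$). Let $\mathrm{Ker}\,D$ be the space of all smooth $S$-valued solutions of $D\sigma=0$ on $\mathbf R^{n+1}_0$. Put $$\mathcal L(\psi)=\sum_i x_i\psi_i,\qquad \mathcal T(\sigma)=\sum_j\Big(\partial_j\sigma+\tfrac1{n+1}\,e_j\cdot D\sigma\Big)\otimes dx^j,\qquad \iota(\sigma)=-\tfrac1{n+1}\sum_i e_i\cdot\sigma\otimes dx^i,\qquad \mathcal T'=\tfrac2{n+1}\,\mathcal T\circ\iota^{-1},$$ $$\Xi(\phi)=\frac1{2(n+k-1)}\Big(\|x\|^2\,\mathcal T(\phi)+(n+1)\sum_j x_j\phi\otimes dx^j+\sum_j e_j\cdot(x\cdot\phi)\otimes dx^j\Big)\quad(\phi\in\mathcal P_{k-1}(0)).$$ Let $\mathcal M^1$ be the space of sections $\psi$ of $S_{3/2}$ on $\mathbf R^{n+1}_0$ with $\mathcal L(\psi)=0$, let $\mathcal M^2=\mathcal T'(\mathrm{Ker}\,D)$, where $\mathrm{Ker}\,D$ is identified with $\iota(\mathrm{Ker}\,D)$, and let $\mathcal M^3=\Xi(\mathcal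 P_{k-1}(0))$. Then every $\psi\in\mathcal P_k(1)$ has a unique decomposition $\psi=\psi_1+\psi_2+\psi_3$ into $k$-homogeneous pieces $\psi_j\in\mathcal M^j$, $j=1,2,3$, and these pieces lie again in $\mathcal P_k(1)$. Moreover, every element of $\mathcal M^2$ is a section $\psi$ of $S_{3/2}$ with $D\mathcal L(\psi)=0$, and every element of $\mathcal M^3$ is a section $\psi$ of $S_{3/2}$ such that $D\mathcal L(\psi)\not\equiv0$ unless $\psi=0$. -/

import Mathlib

open scoped ContDiff

noncomputable section

namespace RaritaSchwinger

/-- Euclidean space `ℝ^{n+1}`. -/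
abbrev Space (n : ℕ) : Type := EuclideanSpace ℝ (Fin (n + 1))

/-- The punctured space `ℝ^{n+1} \ {0}`. Fields on it are given by functions on the whole space,
and only their values on `punctured n` ever matter. -/
def punctured (n : ℕ) : Set (Space n) := {0}ᶜ

/-- The vector `e_i = ∂/∂x_i` of the standard orthonormal frame. -/
def e {n : ℕ} (i : Fin (n + 1)) : Space n := EuclideanSpace.single i 1

/-- The quadratic form `Q(v) = -‖v‖²`, so that `v · v = -‖v‖²` in its Clifford algebra. -/
def negNormSq (n : ℕ) : QuadraticForm ℝ (Space n) :=
  -(LinearMap.BilinMap.toQuadraticMap (innerₗ (Space n)))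

theorem negNormSq_apply (n : ℕ) (v : Space n) : negNormSq n v = -‖v‖ ^ 2 := by
  simp [negNormSq]

/-- Complex representations of the Clifford algebra of `ℝ^{n+1}` with `v · v = -‖v‖²`. -/
abbrev CliffordRep (n : ℕ) (S : Type*) [NormedAddCommGroup S] [NormedSpace ℂ S] : Type _ :=
  CliffordAlgebra (negNormSq n) →ₐ[ℝ] Module.End ℂ S

section Definitions

variable {n : ℕ} {S : Type*} [NormedAddCommGroup S] [NormedSpace ℂ S]

/-- `S` with the Clifford action `ρ` is a spinor module: a nonzero irreducible complex
representation of the Clifford algebra. As a representation of `Spin(n+1)` it is the basic spinor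
representation `S_{1/2}` (equal to `S⁺ ⊕ S⁻` if `n + 1` is even). -/
def IsSpinorModule (ρ : CliffordRep n S) : Prop :=
  Nontrivial S ∧
    ∀ W : Submodule ℂ S, (∀ a : CliffordAlgebra (negNormSq n), ∀ s ∈ W, ρ a s ∈ W) →
      W = ⊥ ∨ W = ⊤

/-- Clifford multiplication `v · s` of a spinor by a vector. -/
def cl (ρ : CliffordRep n S) (v : Space n) (s : S) : S :=
  ρ (CliffordAlgebra.ι (negNormSq n) v) s

theorem cl_cl (ρ : CliffordRep n S) (v : Space n) (s : S) :
    cl ρ v (cl ρ v s) = -(‖v‖ ^ 2 • s) := by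
  unfold cl
  rw [← Module.End.mul_apply, ← map_mul, CliffordAlgebra.ι_sq_scalar, AlgHom.commutes,
    negNormSq_apply, Module.algebraMap_end_apply, neg_smul]

/-- The flat covariant derivative `∇_{e_i} = ∂/∂x_i`. -/
def partialD {V : Type*} [NormedAddCommGroup V] [NormedSpace ℝ V] (i : Fin (n + 1))
    (f : Space n → V) (x : Space n) : V :=
  fderiv ℝ f x (e i)

/-- The Dirac operator `D σ = ∑ e_i · ∂_i σ`. -/
def dirac (ρ : CliffordRep n S) (σ : Space n → S) (x : Space n) : S :=
  ∑ i, cl ρ (e i) (partialD i σ x)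

/-! An element `∑ w_i ⊗ dx^i` of `S_{1/2} ⊗ (ℂ^{n+1})^*` is given by its components
`w : Fin (n + 1) → S`. -/

/-- `μ (∑ w_i ⊗ dx^i) = ∑ e_i · w_i`. -/
def mu (ρ : CliffordRep n S) (w : Fin (n + 1) → S) : S :=
  ∑ i, cl ρ (e i) (w i)

/-- The embedding `ι(s) = -1/(n+1) ∑ e_i · s ⊗ dx^i` of `S_{1/2}` onto `S_{1/2}'`. -/
def iota (ρ : CliffordRep n S) (s : S) : Fin (n + 1) → S :=
  fun i => -((1 / ((n : ℝ) + 1)) • cl ρ (e i) s)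

/-- The projection `π_{3/2}` onto `S_{3/2} = Ker μ`. -/
def proj32 (ρ : CliffordRep n S) (w : Fin (n + 1) → S) : Fin (n + 1) → S :=
  fun j => w j + (1 / ((n : ℝ) + 1)) • cl ρ (e j) (mu ρ w)

/-- `∇ σ = ∑ ∂_i σ ⊗ dx^i`. -/
def grad (σ : Space n → S) (x : Space n) : Fin (n + 1) → S :=
  fun i => partialD i σ x

/-- The twistor operator `T = π_{3/2} ∘ ∇`. -/
def twistor (ρ : CliffordRep n S) (σ : Space n → S) (x : Space n) : Fin (n + 1) → S :=
  proj32 ρ (grad σ x)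

/-- The operator `T' = 2/(n+1) T ∘ ι⁻¹` on sections of `S_{1/2}'`; here `ι⁻¹` is the restriction
of `μ` to `S_{1/2}' = ι(S_{1/2})`, see `mu_iota`. -/
def twistor' (ρ : CliffordRep n S) (η : Space n → Fin (n + 1) → S) (x : Space n) :
    Fin (n + 1) → S :=
  (2 / ((n : ℝ) + 1)) • twistor ρ (fun y => mu ρ (η y)) x

/-- The twisted Dirac operator `D_T (∑ ψ_i ⊗ dx^i) = ∑ D ψ_i ⊗ dx^i`. -/
def twistedDirac (ρ : CliffordRep n S) (ψ : Space n → Fin (n + 1) → S) (x : Space n) :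
    Fin (n + 1) → S :=
  fun i => dirac ρ (fun y => ψ y i) x

/-- The Rarita-Schwinger operator
`R ψ = π_{3/2} (D_T ψ) = ∑ (D ψ_i + 1/(n+1) e_i · ∑_k e_k · D ψ_k) ⊗ dx^i`. -/
def raritaSchwinger (ρ : CliffordRep n S) (ψ : Space n → Fin (n + 1) → S) (x : Space n) :
    Fin (n + 1) → S :=
  proj32 ρ (twistedDirac ρ ψ x)

/-- `L(ψ) = ∑ x_i ψ_i`. -/
def contractL (ψ : Space n → Fin (n + 1) → S) (x : Space n) : S :=
  ∑ i, x i • ψ x i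

/-- `Ξ(φ) = 1/(2(n+k-1)) (‖x‖² T(φ) + (n+1) ∑ x_j φ ⊗ dx^j + ∑ e_j · (x · φ) ⊗ dx^j)`. -/
def Xi (ρ : CliffordRep n S) (k : ℕ) (φ : Space n → S) (x : Space n) : Fin (n + 1) → S :=
  fun j => (1 / (2 * ((n : ℝ) + (k : ℝ) - 1))) •
    (‖x‖ ^ 2 • twistor ρ φ x j + (((n : ℝ) + 1) * x j) • φ x + cl ρ (e j) (cl ρ x (φ x)))

/-- `f` is a polynomial map on the punctured space with values in `V`. -/
def IsPolynomial {V : Type*} [NormedAddCommGroup V] [NormedSpace ℝ V] (f : Space n → V) : Prop :=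
  ∃ P : (Fin (n + 1) →₀ ℕ) →₀ V,
    ∀ x ∈ punctured n, f x = P.sum fun α v => (∏ i, x i ^ α i) • v

/-- `f` is homogeneous of degree `k` on the punctured space. -/
def IsHomogeneous {V : Type*} [NormedAddCommGroup V] [NormedSpace ℝ V] (k : ℤ)
    (f : Space n → V) : Prop :=
  ∀ t : ℝ, 0 < t → ∀ x ∈ punctured n, f (t • x) = t ^ k • f x

/-- Smooth sections over the punctured space of `S_{3/2} = Ker μ`. -/
def Gamma32 (ρ : CliffordRep n S) : Set (Space n → Fin (n + 1) → S) :=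
  {ψ | ContDiffOn ℝ ∞ ψ (punctured n) ∧ ∀ x ∈ punctured n, mu ρ (ψ x) = 0}

/-- `Ker D`: the smooth solutions of the Dirac equation on the punctured space. -/
def kerD (ρ : CliffordRep n S) : Set (Space n → S) :=
  {σ | ContDiffOn ℝ ∞ σ (punctured n) ∧ ∀ x ∈ punctured n, dirac ρ σ x = 0}

/-- `P_k(0)`: the polynomial `k`-homogeneous solutions of the Dirac equation. There are no nonzero
ones if `k < 0`. -/
def P0 (ρ : CliffordRep n S) (k : ℤ) : Set (Space n → S) :=
  {φ | φ ∈ kerD ρ ∧ IsPolynomial φ ∧ IsHomogeneous k φ}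

/-- `P_k(1)`: the polynomial `k`-homogeneous solutions of the Rarita-Schwinger equation. -/
def P1 (ρ : CliffordRep n S) (k : ℤ) : Set (Space n → Fin (n + 1) → S) :=
  {ψ | ψ ∈ Gamma32 ρ ∧ (∀ x ∈ punctured n, raritaSchwinger ρ ψ x = 0) ∧
    IsPolynomial ψ ∧ IsHomogeneous k ψ}

/-- `M¹`: the sections of `S_{3/2}` in the kernel of `L`. -/
def M1 (ρ : CliffordRep n S) : Set (Space n → Fin (n + 1) → S) :=
  {ψ | ψ ∈ Gamma32 ρ ∧ ∀ x ∈ punctured n, contractL ψ x = 0}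

/-- `M² = T'(Ker D)`, with `Ker D` regarded as a space of sections of `S_{1/2}'` through `ι`. -/
def M2 (ρ : CliffordRep n S) : Set (Space n → Fin (n + 1) → S) :=
  {ψ | ∃ σ ∈ kerD ρ, Set.EqOn ψ (twistor' ρ fun y => iota ρ (σ y)) (punctured n)}

/-- `M³ = Ξ(P_{k-1}(0))`. -/
def M3 (ρ : CliffordRep n S) (k : ℕ) : Set (Space n → Fin (n + 1) → S) :=
  {ψ | ∃ φ ∈ P0 ρ ((k : ℤ) - 1), Set.EqOn ψ (Xi ρ k φ) (punctured n)}

theorem mu_iota (ρ : CliffordRep n S) (s : S) : mu ρ (iota ρ s) = s := by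
  have h : ∀ i : Fin (n + 1), cl ρ (e i) (iota ρ s i) = (1 / ((n : ℝ) + 1)) • s := by
    intro i
    have h1 : cl ρ (e i) (iota ρ s i) = -((1 / ((n : ℝ) + 1)) • cl ρ (e i) (cl ρ (e i) s)) := by
      simp only [cl, iota, map_neg]
      congr 1
      exact LinearMap.map_smul_of_tower _ _ _
    rw [h1, cl_cl]
    simp [e]
  unfold mu
  rw [Finset.sum_congr rfl fun i _ => h i, Finset.sum_const, Finset.card_univ, Fintype.card_fin,
    ← Nat.cast_smul_eq_nsmul ℝ, smul_smul]
  have h2 : ((n : ℝ) + 1) ≠ 0 := by positivity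
  push_cast
  rw [mul_one_div_cancel h2, one_smul]

end Definitions

end RaritaSchwinger

end

open RaritaSchwinger

/-! Everything is controlled by the divergence `δ = ∑ ∂_i ψ_i`. Applying `D` to `μ(ψ) = 0` gives
`μ(D_T ψ) = -2δ`, so the Rarita–Schwinger equation becomes `Dψ_i = 2/(n+1) e_i · δ` (`mem_P1`).
Taking `∂_i` and summing yields `Dδ = 2/(n+1) Dδ`, hence `Dδ = 0` because `n ≥ 2`
(`dirac_divergence`).

Existence: `Ξ(φ)` solves the equation with divergence `(n+1)/2 φ` (`xiField_mem_P1`,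
`divergence_xiField_normalized`), so subtracting `Ξ(2/(n+1) δ)` leaves a divergence-free solution,
whose components are killed by `D`. Its contraction `σ = L(·)` then satisfies `Dσ = 0` and has
degree `k+1`; by Euler's identity `∇σ/(k+1)` has the same contraction, and subtracting it leaves an
element of `M¹`.

Uniqueness: `D ∘ L` kills `M¹` and `M²` and sends `Ξ(φ)` to `x · φ`, which determines `φ` since `x ≠
0` (`eqOn_of_mem_M3`). Finally, `M¹` and `M²` share no nonzero field of degree `k`, since `L(∇σ) =
0` forces `∇σ` to have degree `-1` (`eq_zero_of_mem_M2`). -/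

noncomputable section

namespace RaritaSchwinger

/-! ### Partial derivatives, homogeneity and polynomiality on the punctured space -/

section Calculus

variable {n : ℕ} {V W : Type*} [NormedAddCommGroup V] [NormedSpace ℝ V]
  [NormedAddCommGroup W] [NormedSpace ℝ W] {f g : Space n → V} {x : Space n}

theorem isOpen_punctured (n : ℕ) : IsOpen (punctured n) := isOpen_compl_singleton

theorem smul_mem_punctured {t : ℝ} (ht : 0 < t) (hx : x ∈ punctured n) : t • x ∈ punctured n :=
  smul_ne_zero ht.ne' hx

theorem differentiableAt_of_smooth (hf : ContDiffOn ℝ ∞ f (punctured n)) (hx : x ∈ punctured n) :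
    DifferentiableAt ℝ f x :=
  (hf.contDiffAt ((isOpen_punctured n).mem_nhds hx)).differentiableAt (by simp)

theorem smooth_partialD (i : Fin (n + 1)) (hf : ContDiffOn ℝ ∞ f (punctured n)) :
    ContDiffOn ℝ ∞ (partialD i f) (punctured n) :=
  (hf.fderiv_of_isOpen (isOpen_punctured n) (by simp)).clm_apply contDiffOn_const

theorem smooth_coord (i : Fin (n + 1)) : ContDiff ℝ ∞ fun y : Space n => y i := by fun_prop

theorem smooth_coord_smul (i : Fin (n + 1)) (hf : ContDiffOn ℝ ∞ f (punctured n)) :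
    ContDiffOn ℝ ∞ (fun y => y i • f y) (punctured n) :=
  (smooth_coord i).contDiffOn.smul hf

theorem smooth_normSq_smul (hf : ContDiffOn ℝ ∞ f (punctured n)) :
    ContDiffOn ℝ ∞ (fun y => ‖y‖ ^ 2 • f y) (punctured n) :=
  (contDiff_norm_sq ℝ).contDiffOn.smul hf

theorem smooth_clm (A : V →L[ℝ] W) (hf : ContDiffOn ℝ ∞ f (punctured n)) :
    ContDiffOn ℝ ∞ (fun y => A (f y)) (punctured n) :=
  A.contDiff.comp_contDiffOn hf

/-- The punctured space is open, so identities valid only there may be differentiated. -/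
theorem partialD_congr (i : Fin (n + 1)) (h : Set.EqOn f g (punctured n)) :
    Set.EqOn (partialD i f) (partialD i g) (punctured n) := fun x hx => by
  unfold partialD
  rw [Filter.EventuallyEq.fderiv_eq (h.eventuallyEq_of_mem ((isOpen_punctured n).mem_nhds hx))]

theorem partialD_add (i : Fin (n + 1)) (hf : ContDiffOn ℝ ∞ f (punctured n))
    (hg : ContDiffOn ℝ ∞ g (punctured n)) (hx : x ∈ punctured n) :
    partialD i (fun y => f y + g y) x = partialD i f x + partialD i g x := by
  unfold partialD
  rw [fderiv_fun_add (differentiableAt_of_smooth hf hx) (differentiableAt_of_smooth hg hx)]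
  rfl

theorem partialD_sub (i : Fin (n + 1)) (hf : ContDiffOn ℝ ∞ f (punctured n))
    (hg : ContDiffOn ℝ ∞ g (punctured n)) (hx : x ∈ punctured n) :
    partialD i (fun y => f y - g y) x = partialD i f x - partialD i g x := by
  unfold partialD
  rw [fderiv_fun_sub (differentiableAt_of_smooth hf hx) (differentiableAt_of_smooth hg hx)]
  rfl

theorem partialD_sum {ι : Type*} (s : Finset ι) {F : ι → Space n → V} (i : Fin (n + 1))
    (hF : ∀ j ∈ s, ContDiffOn ℝ ∞ (F j) (punctured n)) (hx : x ∈ punctured n) :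
    partialD i (fun y => ∑ j ∈ s, F j y) x = ∑ j ∈ s, partialD i (F j) x := by
  unfold partialD
  rw [fderiv_fun_sum fun j hj => differentiableAt_of_smooth (hF j hj) hx]
  simp

theorem partialD_clm (i : Fin (n + 1)) (A : V →L[ℝ] W) (hf : ContDiffOn ℝ ∞ f (punctured n))
    (hx : x ∈ punctured n) : partialD i (fun y => A (f y)) x = A (partialD i f x) := by
  unfold partialD
  have := A.hasFDerivAt.comp x (differentiableAt_of_smooth hf hx).hasFDerivAt
  rw [show (fun y => A (f y)) = A ∘ f from rfl, this.fderiv]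
  rfl

theorem partialD_const_smul (i : Fin (n + 1)) (c : ℝ) (hf : ContDiffOn ℝ ∞ f (punctured n))
    (hx : x ∈ punctured n) : partialD i (fun y => c • f y) x = c • partialD i f x :=
  partialD_clm i (c • ContinuousLinearMap.id ℝ V) hf hx

theorem partialD_coord_smul (i j : Fin (n + 1)) (hf : ContDiffOn ℝ ∞ f (punctured n))
    (hx : x ∈ punctured n) :
    partialD i (fun y => y j • f y) x = (if i = j then f x else 0) + x j • partialD i f x := by
  have h1 : HasFDerivAt (fun y : Space n => y j) (EuclideanSpace.proj j : Space n →L[ℝ] ℝ) x :=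
    (EuclideanSpace.proj j : Space n →L[ℝ] ℝ).hasFDerivAt
  unfold partialD
  rw [(h1.fun_smul (differentiableAt_of_smooth hf hx).hasFDerivAt).fderiv]
  by_cases h : i = j
  · simp [e, h, add_comm]
  · simp [e, h, Ne.symm h]

theorem partialD_normSq_smul (i : Fin (n + 1)) (hf : ContDiffOn ℝ ∞ f (punctured n))
    (hx : x ∈ punctured n) :
    partialD i (fun y => ‖y‖ ^ 2 • f y) x = (2 * x i) • f x + ‖x‖ ^ 2 • partialD i f x := by
  unfold partialD
  rw [((hasStrictFDerivAt_norm_sq x).hasFDerivAt.fun_smul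
    (differentiableAt_of_smooth hf hx).hasFDerivAt).fderiv]
  simp [e, add_comm, two_mul, EuclideanSpace.inner_single_right]

theorem partialD_comm (i j : Fin (n + 1)) (hf : ContDiffOn ℝ ∞ f (punctured n))
    (hx : x ∈ punctured n) : partialD i (partialD j f) x = partialD j (partialD i f) x := by
  have hc := hf.contDiffAt ((isOpen_punctured n).mem_nhds hx)
  have hs : IsSymmSndFDerivAt ℝ f x := hc.isSymmSndFDerivAt (by
    simpa using WithTop.coe_le_coe.2 (le_top (a := (2 : ℕ∞))))
  have hd : DifferentiableAt ℝ (fderiv ℝ f) x :=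
    differentiableAt_of_smooth (hf.fderiv_of_isOpen (isOpen_punctured n) (by simp)) hx
  have key : ∀ a b : Fin (n + 1),
      partialD a (partialD b f) x = fderiv ℝ (fderiv ℝ f) x (e a) (e b) := fun a b => by
    have h := (hd.hasFDerivAt.clm_apply (hasFDerivAt_const (e b) x)).fderiv
    change fderiv ℝ (fun y => fderiv ℝ f y (e b)) x (e a) = _
    rw [h]
    simp
  rw [key, key, hs.eq]

theorem sum_smul_partialD (f : Space n → V) (x v : Space n) :
    ∑ i, v i • partialD i f x = fderiv ℝ f x v := by
  conv_rhs => rw [← (EuclideanSpace.basisFun (Fin (n + 1)) ℝ).sum_repr v]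
  simp [partialD, e]

theorem IsHomogeneous.euler {m : ℤ} (h : IsHomogeneous m f)
    (hf : ContDiffOn ℝ ∞ f (punctured n)) (hx : x ∈ punctured n) :
    ∑ i, x i • partialD i f x = (m : ℝ) • f x := by
  rw [sum_smul_partialD]
  have h1 : HasDerivAt (fun t : ℝ => t • x) x 1 := by
    simpa using (hasDerivAt_id (1 : ℝ)).smul_const x
  have h0 : HasFDerivAt f (fderiv ℝ f x) ((1 : ℝ) • x) := by
    rw [one_smul]; exact (differentiableAt_of_smooth hf hx).hasFDerivAt
  have h2 : HasDerivAt (fun t : ℝ => f (t • x)) (fderiv ℝ f x x) 1 := h0.comp_hasDerivAt 1 h1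
  have h3 : HasDerivAt (fun t : ℝ => t ^ m • f x) ((m : ℝ) • f x) 1 := by
    simpa using (hasDerivAt_zpow m (1 : ℝ) (by simp)).smul_const (f x)
  refine h2.unique (h3.congr_of_eventuallyEq ?_)
  -- Homogeneity is available only for `t > 0`, which suffices near `t = 1`.
  filter_upwards [lt_mem_nhds (zero_lt_one (α := ℝ))] with t ht using h t ht x hx

theorem IsHomogeneous.congr {m : ℤ} (h : IsHomogeneous m f) (hfg : Set.EqOn g f (punctured n)) :
    IsHomogeneous m g := fun t ht x hx => by
  rw [hfg hx, hfg (smul_mem_punctured ht hx), h t ht x hx]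

theorem IsHomogeneous.clm {m : ℤ} (h : IsHomogeneous m f) (A : V →L[ℝ] W) :
    IsHomogeneous m fun y => A (f y) := fun t ht x hx => by
  simp only [h t ht x hx, map_smul]

theorem IsHomogeneous.add {m : ℤ} (hf : IsHomogeneous m f) (hg : IsHomogeneous m g) :
    IsHomogeneous m fun y => f y + g y := fun t ht x hx => by
  simp only [hf t ht x hx, hg t ht x hx, smul_add]

theorem IsHomogeneous.sub {m : ℤ} (hf : IsHomogeneous m f) (hg : IsHomogeneous m g) :
    IsHomogeneous m fun y => f y - g y := fun t ht x hx => by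
  simp only [hf t ht x hx, hg t ht x hx, smul_sub]

theorem IsHomogeneous.const_smul {m : ℤ} (hf : IsHomogeneous m f) (c : ℝ) :
    IsHomogeneous m fun y => c • f y :=
  hf.clm (c • ContinuousLinearMap.id ℝ V)

theorem IsHomogeneous.sum {ι : Type*} {s : Finset ι} {F : ι → Space n → V} {m : ℤ}
    (hF : ∀ j ∈ s, IsHomogeneous m (F j)) : IsHomogeneous m fun y => ∑ j ∈ s, F j y :=
  fun t ht x hx => by
    rw [Finset.smul_sum]
    exact Finset.sum_congr rfl fun j hj => hF j hj t ht x hx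

theorem IsHomogeneous.coord_smul {m : ℤ} (hf : IsHomogeneous m f) (i : Fin (n + 1)) :
    IsHomogeneous (m + 1) fun y => y i • f y := fun t ht x hx => by
  simp only [hf t ht x hx, PiLp.smul_apply, smul_eq_mul, smul_smul]
  rw [zpow_add_one₀ ht.ne']
  ring_nf

theorem IsHomogeneous.normSq_smul {m : ℤ} (hf : IsHomogeneous m f) :
    IsHomogeneous (m + 2) fun y => ‖y‖ ^ 2 • f y := fun t ht x hx => by
  simp only [hf t ht x hx, norm_smul, smul_smul, Real.norm_eq_abs, mul_pow, sq_abs]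
  rw [zpow_add₀ ht.ne', zpow_ofNat]
  ring_nf

/-- Differentiating `f(ty) = t^m f(y)` in `y` produces a factor `t` on the left, which is then
divided out. -/
theorem IsHomogeneous.partialD {m : ℤ} (h : IsHomogeneous m f)
    (hf : ContDiffOn ℝ ∞ f (punctured n)) (i : Fin (n + 1)) :
    IsHomogeneous (m - 1) (partialD i f) := fun t ht x hx => by
  have h0 := (differentiableAt_of_smooth hf (smul_mem_punctured ht hx)).hasFDerivAt.comp x
    ((hasFDerivAt_id x).fun_const_smul t)
  have h1 : HasFDerivAt (fun y => t ^ m • f y) (t ^ m • fderiv ℝ f x) x :=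
    (differentiableAt_of_smooth hf hx).hasFDerivAt.fun_const_smul _
  have h2 := h0.unique (h1.congr_of_eventuallyEq (by
    filter_upwards [(isOpen_punctured n).mem_nhds hx] with y hy using h t ht y hy))
  have h3 := congrArg (fun A => t⁻¹ • A (e i)) h2
  simp only [ContinuousLinearMap.comp_apply, smul_apply, map_smul,
    ContinuousLinearMap.id_apply, smul_smul, inv_mul_cancel₀ ht.ne', one_smul] at h3
  unfold RaritaSchwinger.partialD
  rw [h3, zpow_sub_one₀ ht.ne', mul_comm]

theorem isHomogeneous_pi {U : Type*} [NormedAddCommGroup U] [NormedSpace ℝ U] {m : ℤ}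
    {F : Space n → Fin (n + 1) → U} :
    IsHomogeneous m F ↔ ∀ i, IsHomogeneous m fun y => F y i :=
  ⟨fun h i t ht x hx => congrFun (h t ht x hx) i,
    fun h t ht x hx => funext fun i => h i t ht x hx⟩

theorem IsPolynomial.congr (h : IsPolynomial f) (hfg : Set.EqOn g f (punctured n)) :
    IsPolynomial g := by
  obtain ⟨P, hP⟩ := h
  exact ⟨P, fun x hx => (hfg hx).trans (hP x hx)⟩

theorem isPolynomial_const (v : V) : IsPolynomial fun _ : Space n => v :=
  ⟨Finsupp.single 0 v, fun x _ => by simp⟩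

theorem IsPolynomial.add (hf : IsPolynomial f) (hg : IsPolynomial g) :
    IsPolynomial fun y => f y + g y := by
  obtain ⟨P, hP⟩ := hf
  obtain ⟨Q, hQ⟩ := hg
  refine ⟨P + Q, fun x hx => ?_⟩
  simp only [hP x hx, hQ x hx]
  rw [Finsupp.sum_add_index' (by simp) (by simp)]

theorem IsPolynomial.clm (hf : IsPolynomial f) (A : V →L[ℝ] W) :
    IsPolynomial fun y => A (f y) := by
  obtain ⟨P, hP⟩ := hf
  refine ⟨P.mapRange A (map_zero A), fun x hx => ?_⟩
  simp only [hP x hx]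
  rw [Finsupp.sum_mapRange_index (by simp), Finsupp.sum, map_sum]
  simp [Finsupp.sum]

theorem IsPolynomial.const_smul (hf : IsPolynomial f) (c : ℝ) :
    IsPolynomial fun y => c • f y :=
  hf.clm (c • ContinuousLinearMap.id ℝ V)

theorem IsPolynomial.sub (hf : IsPolynomial f) (hg : IsPolynomial g) :
    IsPolynomial fun y => f y - g y :=
  (hf.add (hg.const_smul (-1))).congr fun x _ => by simp [sub_eq_add_neg]

theorem IsPolynomial.sum {ι : Type*} (s : Finset ι) {F : ι → Space n → V}
    (hF : ∀ j ∈ s, IsPolynomial (F j)) : IsPolynomial fun y => ∑ j ∈ s, F j y := by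
  classical
  induction s using Finset.induction_on with
  | empty => simpa using isPolynomial_const (n := n) (0 : V)
  | insert a s ha ih =>
    simp only [Finset.sum_insert ha]
    exact (hF a (by simp)).add (ih fun j hj => hF j (by simp [hj]))

theorem prod_pow_add_single (x : Space n) (α : Fin (n + 1) →₀ ℕ) (i : Fin (n + 1)) :
    ∏ j, x j ^ (α + Finsupp.single i 1 : Fin (n + 1) →₀ ℕ) j = x i * ∏ j, x j ^ α j := by
  simp only [Finsupp.add_apply, pow_add, Finset.prod_mul_distrib]
  rw [mul_comm]
  congr 1
  rw [Finset.prod_eq_single i] <;> simp +contextual [eq_comm]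

theorem IsPolynomial.coord_smul (hf : IsPolynomial f) (i : Fin (n + 1)) :
    IsPolynomial fun y => y i • f y := by
  obtain ⟨P, hP⟩ := hf
  refine ⟨P.mapDomain (· + Finsupp.single i 1), fun x hx => ?_⟩
  simp only [hP x hx]
  rw [Finsupp.sum_mapDomain_index (by simp) (by simp [smul_add]), Finsupp.sum,
    Finset.smul_sum]
  exact Finset.sum_congr rfl fun α _ => by simp only [prod_pow_add_single, smul_smul]

theorem IsPolynomial.normSq_smul (hf : IsPolynomial f) : IsPolynomial fun y => ‖y‖ ^ 2 • f y :=
  (IsPolynomial.sum Finset.univ fun i _ => (hf.coord_smul i).coord_smul i).congr fun x _ => by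
    simp only [EuclideanSpace.real_norm_sq_eq, Finset.sum_smul, smul_smul, ← pow_two]

theorem smooth_monomial (α : Fin (n + 1) →₀ ℕ) (v : V) :
    ContDiff ℝ ∞ fun y : Space n => (∏ i, y i ^ α i) • v := by
  refine ContDiff.smul (contDiff_prod fun i _ => ?_) contDiff_const
  exact (smooth_coord i).pow _

/-- Induction on the degree: split off one variable and use the product rule, so that no explicit
formula with the exponent `α i - 1` is needed. -/
theorem isPolynomial_partialD_monomial (i : Fin (n + 1)) (α : Fin (n + 1) →₀ ℕ) (v : V) :
    IsPolynomial (partialD i fun y : Space n => (∏ j, y j ^ α j) • v) := by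
  induction hm : α.degree generalizing α with
  | zero =>
    obtain rfl : α = 0 := (Finsupp.degree_eq_zero_iff α).1 hm
    refine (isPolynomial_const (0 : V)).congr fun x _ => ?_
    simp [partialD]
  | succ m ih =>
    obtain ⟨j, hj⟩ : ∃ j, α j ≠ 0 := by
      by_contra! h
      have : α = 0 := Finsupp.ext h
      simp [this] at hm
    obtain ⟨β, rfl⟩ : ∃ β, α = β + Finsupp.single j 1 :=
      ⟨α - Finsupp.single j 1, (tsub_add_cancel_of_le (by
        rw [Finsupp.single_le_iff]; omega)).symm⟩
    have hβ : IsPolynomial fun y : Space n => (∏ l, y l ^ β l) • v :=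
      ⟨Finsupp.single β v, fun x _ => by simp⟩
    have hd := ih β (by simpa using hm)
    have h0 : IsPolynomial fun y : Space n =>
        if i = j then (∏ l, y l ^ β l) • v else 0 := by
      split_ifs
      exacts [hβ, isPolynomial_const 0]
    refine (h0.add (hd.coord_smul j)).congr fun x hx => ?_
    simp only [prod_pow_add_single, ← smul_smul]
    exact partialD_coord_smul i j (smooth_monomial β v).contDiffOn hx

theorem IsPolynomial.partialD (hf : IsPolynomial f) (i : Fin (n + 1)) :
    IsPolynomial (partialD i f) := by
  obtain ⟨P, hP⟩ := hf
  refine (IsPolynomial.sum P.support fun α _ =>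
    isPolynomial_partialD_monomial i α (P α)).congr fun x hx => ?_
  rw [partialD_congr i hP hx]
  exact partialD_sum P.support i (fun α _ => (smooth_monomial α (P α)).contDiffOn) hx

theorem isPolynomial_pi {U : Type*} [NormedAddCommGroup U] [NormedSpace ℝ U]
    {F : Space n → Fin (n + 1) → U} :
    IsPolynomial F ↔ ∀ i, IsPolynomial fun y => F y i := by
  refine ⟨fun h i => h.clm (ContinuousLinearMap.proj i), fun h => ?_⟩
  refine (IsPolynomial.sum Finset.univ fun i _ =>
    (h i).clm (ContinuousLinearMap.single ℝ (fun _ : Fin (n + 1) => U) i)).congr fun x _ => ?_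
  exact (Finset.univ_sum_single (F x)).symm

end Calculus

/-! ### Clifford multiplication and commutation rules for the Dirac operator -/

section Dirac

variable {n : ℕ} {S : Type*} [NormedAddCommGroup S] [NormedSpace ℂ S]
  {ρ : CliffordRep n S} {f g : Space n → S} {x : Space n}

theorem cl_add_left (ρ : CliffordRep n S) (u v : Space n) (s : S) :
    cl ρ (u + v) s = cl ρ u s + cl ρ v s := by
  simp [cl]

theorem cl_eq_sum (ρ : CliffordRep n S) (x : Space n) (s : S) :
    cl ρ x s = ∑ i, x i • cl ρ (e i) s := by
  have h : x = ∑ i, x i • e i := by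
    simpa [e] using ((EuclideanSpace.basisFun (Fin (n + 1)) ℝ).sum_repr x).symm
  conv_lhs => rw [h]
  simp [cl]

/-- Polarization of `v · v = -‖v‖²` at `v = e_i + e_j`. -/
theorem cl_anticomm (ρ : CliffordRep n S) (i j : Fin (n + 1)) (s : S) :
    cl ρ (e i) (cl ρ (e j) s) =
      -cl ρ (e j) (cl ρ (e i) s) - if i = j then (2 : ℝ) • s else 0 := by
  have h := cl_cl ρ (e i + e j) s
  have hadd : ∀ (v : Space n) (a b : S), cl ρ v (a + b) = cl ρ v a + cl ρ v b :=
    fun v a b => map_add _ a b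
  rw [cl_add_left, cl_add_left, hadd, hadd, cl_cl, cl_cl] at h
  have hn : ‖e i + e j‖ ^ 2 = 2 + if i = j then (2 : ℝ) else 0 := by
    rw [norm_add_sq_real]
    by_cases hij : i = j
    · subst hij; simp [e]; norm_num
    · simp [e, hij, EuclideanSpace.inner_single_left]; norm_num
  have h1 : ∀ l : Fin (n + 1), ‖(e l : Space n)‖ = 1 := fun l => by simp [e]
  rw [hn, h1, h1] at h
  split_ifs at h ⊢ with hij
  · subst hij
    rw [cl_cl, h1]
    module
  · rw [sub_zero, eq_neg_iff_add_eq_zero]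
    linear_combination (norm := module) h

theorem cl_eq_zero {v : Space n} (hv : v ≠ 0) {s : S} (h : cl ρ v s = 0) : s = 0 := by
  have h1 := cl_cl ρ v s
  rw [h, show cl ρ v 0 = 0 from map_zero _] at h1
  have h2 := neg_eq_zero.1 h1.symm
  exact (smul_eq_zero.1 h2).resolve_left (by simpa using hv)

theorem dirac_congr (h : Set.EqOn f g (punctured n)) :
    Set.EqOn (dirac ρ f) (dirac ρ g) (punctured n) := fun x hx =>
  Finset.sum_congr rfl fun i _ => by rw [partialD_congr i h hx]

variable [FiniteDimensional ℂ S]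

/-- Clifford multiplication by a fixed vector as a continuous real linear map. -/
def clL (ρ : CliffordRep n S) (v : Space n) : S →L[ℝ] S :=
  haveI : FiniteDimensional ℝ S := FiniteDimensional.complexToReal S
  LinearMap.toContinuousLinearMap ((ρ (CliffordAlgebra.ι (negNormSq n) v)).restrictScalars ℝ)

theorem clL_apply (ρ : CliffordRep n S) (v : Space n) (s : S) : clL ρ v s = cl ρ v s := rfl

theorem smooth_cl (v : Space n) (hf : ContDiffOn ℝ ∞ f (punctured n)) :
    ContDiffOn ℝ ∞ (fun y => cl ρ v (f y)) (punctured n) :=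
  smooth_clm (clL ρ v) hf

theorem smooth_cl_pos (hf : ContDiffOn ℝ ∞ f (punctured n)) :
    ContDiffOn ℝ ∞ (fun y => cl ρ y (f y)) (punctured n) := by
  rw [show (fun y => cl ρ y (f y)) = fun y => ∑ i, y i • cl ρ (e i) (f y) from
    funext fun y => cl_eq_sum ρ y (f y)]
  exact ContDiffOn.sum fun i _ => smooth_coord_smul i (smooth_cl _ hf)

theorem dirac_eq_zero_of_eqOn (h : ∀ y ∈ punctured n, f y = 0) (hx : x ∈ punctured n) :
    dirac ρ f x = 0 := by
  rw [dirac_congr (g := fun _ => 0) h hx]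
  simp [dirac, partialD, ← clL_apply]

theorem dirac_add (hf : ContDiffOn ℝ ∞ f (punctured n)) (hg : ContDiffOn ℝ ∞ g (punctured n))
    (hx : x ∈ punctured n) : dirac ρ (fun y => f y + g y) x = dirac ρ f x + dirac ρ g x := by
  simp only [dirac, partialD_add _ hf hg hx, ← clL_apply, map_add, Finset.sum_add_distrib]

theorem dirac_sub (hf : ContDiffOn ℝ ∞ f (punctured n)) (hg : ContDiffOn ℝ ∞ g (punctured n))
    (hx : x ∈ punctured n) : dirac ρ (fun y => f y - g y) x = dirac ρ f x - dirac ρ g x := by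
  simp only [dirac, partialD_sub _ hf hg hx, ← clL_apply, map_sub, Finset.sum_sub_distrib]

theorem dirac_sum {ι : Type*} (s : Finset ι) {F : ι → Space n → S}
    (hF : ∀ j ∈ s, ContDiffOn ℝ ∞ (F j) (punctured n)) (hx : x ∈ punctured n) :
    dirac ρ (fun y => ∑ j ∈ s, F j y) x = ∑ j ∈ s, dirac ρ (F j) x := by
  simp only [dirac, partialD_sum s _ hF hx, ← clL_apply, map_sum]
  exact Finset.sum_comm

theorem dirac_const_smul (c : ℝ) (hf : ContDiffOn ℝ ∞ f (punctured n)) (hx : x ∈ punctured n) :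
    dirac ρ (fun y => c • f y) x = c • dirac ρ f x := by
  simp only [dirac, partialD_const_smul _ c hf hx, ← clL_apply, map_smul, Finset.smul_sum]

theorem dirac_coord_smul (j : Fin (n + 1)) (hf : ContDiffOn ℝ ∞ f (punctured n))
    (hx : x ∈ punctured n) :
    dirac ρ (fun y => y j • f y) x = cl ρ (e j) (f x) + x j • dirac ρ f x := by
  simp only [dirac, partialD_coord_smul _ j hf hx, ← clL_apply, map_add, map_smul,
    Finset.sum_add_distrib, Finset.smul_sum]
  congr 1
  rw [Finset.sum_eq_single j] <;> simp +contextual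

theorem dirac_normSq_smul (hf : ContDiffOn ℝ ∞ f (punctured n)) (hx : x ∈ punctured n) :
    dirac ρ (fun y => ‖y‖ ^ 2 • f y) x = (2 : ℝ) • cl ρ x (f x) + ‖x‖ ^ 2 • dirac ρ f x := by
  rw [cl_eq_sum]
  simp only [dirac, partialD_normSq_smul _ hf hx, ← clL_apply, map_add, map_smul,
    Finset.sum_add_distrib, Finset.smul_sum, smul_smul]

theorem dirac_cl (j : Fin (n + 1)) (hf : ContDiffOn ℝ ∞ f (punctured n)) (hx : x ∈ punctured n) :
    dirac ρ (fun y => cl ρ (e j) (f y)) x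
      = -cl ρ (e j) (dirac ρ f x) - (2 : ℝ) • partialD j f x := by
  have h : ∀ i, partialD i (fun y => cl ρ (e j) (f y)) x = cl ρ (e j) (partialD i f x) :=
    fun i => partialD_clm i (clL ρ (e j)) hf hx
  simp only [dirac, h]
  simp only [cl_anticomm ρ _ j, Finset.sum_sub_distrib, Finset.sum_neg_distrib]
  simp only [← clL_apply, map_sum]
  simp

theorem dirac_partialD (j : Fin (n + 1)) (hf : ContDiffOn ℝ ∞ f (punctured n))
    (hx : x ∈ punctured n) : dirac ρ (partialD j f) x = partialD j (dirac ρ f) x := by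
  unfold dirac
  rw [partialD_sum _ j (fun i _ => smooth_cl _ (smooth_partialD i hf)) hx]
  refine Finset.sum_congr rfl fun i _ => ?_
  rw [partialD_comm i j hf hx]
  exact (partialD_clm j (clL ρ (e i)) (smooth_partialD i hf) hx).symm

/-- Moving the outer `D` past each `e_i` by `dirac_cl` gives `D²f = -D²f - 2∑ ∂_i²f`; solve for
`D²f`. -/
theorem dirac_dirac (hf : ContDiffOn ℝ ∞ f (punctured n)) (hx : x ∈ punctured n) :
    dirac ρ (dirac ρ f) x = -∑ i, partialD i (partialD i f) x := by
  have h : dirac ρ (dirac ρ f) x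
      = ∑ i, (-cl ρ (e i) (dirac ρ (partialD i f) x) - (2 : ℝ) • partialD i (partialD i f) x) :=
    (dirac_sum Finset.univ (fun i _ => smooth_cl _ (smooth_partialD i hf)) hx).trans
      (Finset.sum_congr rfl fun i _ => dirac_cl i (smooth_partialD i hf) hx)
  have h2 : ∑ i, cl ρ (e i) (dirac ρ (partialD i f) x) = dirac ρ (dirac ρ f) x :=
    Finset.sum_congr rfl fun i _ => by rw [dirac_partialD i hf hx]
  rw [Finset.sum_sub_distrib, Finset.sum_neg_distrib, h2, ← Finset.smul_sum] at h
  have h3 : (2 : ℝ) • dirac ρ (dirac ρ f) x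
      = (2 : ℝ) • -∑ i, partialD i (partialD i f) x := by
    linear_combination (norm := module) h
  exact smul_right_injective S (two_ne_zero (α := ℝ)) h3

/-- In `x · f = ∑ x_i e_i · f`, differentiating `x_i` gives `e_i · e_i · f = -f`, and moving `D`
past `e_i` gives the Euler term. -/
theorem dirac_cl_pos (hf : ContDiffOn ℝ ∞ f (punctured n)) (hx : x ∈ punctured n) :
    dirac ρ (fun y => cl ρ y (f y)) x = -((n : ℝ) + 1) • f x
      - (2 : ℝ) • ∑ i, x i • partialD i f x - cl ρ x (dirac ρ f x) := by
  have h : ∀ i, dirac ρ (fun y => y i • cl ρ (e i) (f y)) x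
      = -f x - (2 : ℝ) • (x i • partialD i f x) - x i • cl ρ (e i) (dirac ρ f x) := fun i => by
    rw [dirac_coord_smul i (smooth_cl _ hf) hx, dirac_cl i hf hx, cl_cl]
    simp only [e, PiLp.norm_single, norm_one, one_pow]
    module
  rw [show (fun y => cl ρ y (f y)) = fun y => ∑ i, y i • cl ρ (e i) (f y) from
    funext fun y => cl_eq_sum ρ y (f y)]
  rw [dirac_sum _ (fun i _ => smooth_coord_smul i (smooth_cl _ hf)) hx]
  simp only [h, Finset.sum_sub_distrib, ← Finset.smul_sum, ← cl_eq_sum]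
  congr 2
  simp only [Finset.sum_const, Finset.card_univ, Fintype.card_fin, ← Nat.cast_smul_eq_nsmul ℝ]
  push_cast
  module

end Dirac

/-! ### Divergence, contraction and the Rarita–Schwinger equation in components -/

section Sections

variable {n : ℕ} {S : Type*} [NormedAddCommGroup S] [NormedSpace ℂ S]
  {ρ : CliffordRep n S} {ψ χ : Space n → Fin (n + 1) → S} {x : Space n} {k : ℤ}

/-- The divergence `∑ ∂_i ψ_i`. -/
def divergence (ψ : Space n → Fin (n + 1) → S) (x : Space n) : S :=
  ∑ i, partialD i (fun y => ψ y i) x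

theorem smooth_divergence (h : ∀ i, ContDiffOn ℝ ∞ (fun y => ψ y i) (punctured n)) :
    ContDiffOn ℝ ∞ (divergence ψ) (punctured n) :=
  ContDiffOn.sum fun i _ => smooth_partialD i (h i)

theorem smooth_contractL (h : ∀ i, ContDiffOn ℝ ∞ (fun y => ψ y i) (punctured n)) :
    ContDiffOn ℝ ∞ (contractL ψ) (punctured n) :=
  ContDiffOn.sum fun i _ => smooth_coord_smul i (h i)

theorem divergence_sub (hψ : ∀ i, ContDiffOn ℝ ∞ (fun y => ψ y i) (punctured n))
    (hχ : ∀ i, ContDiffOn ℝ ∞ (fun y => χ y i) (punctured n)) (hx : x ∈ punctured n) :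
    divergence (fun y i => ψ y i - χ y i) x = divergence ψ x - divergence χ x := by
  simp only [divergence, partialD_sub _ (hψ _) (hχ _) hx, Finset.sum_sub_distrib]

theorem contractL_congr (h : Set.EqOn ψ χ (punctured n)) :
    Set.EqOn (contractL ψ) (contractL χ) (punctured n) := fun x hx => by
  simp only [contractL, h hx]

theorem contractL_sub (ψ χ : Space n → Fin (n + 1) → S) (x : Space n) :
    contractL (fun y i => ψ y i - χ y i) x = contractL ψ x - contractL χ x := by
  simp only [contractL, smul_sub, Finset.sum_sub_distrib]

theorem mem_Gamma32 : ψ ∈ Gamma32 ρ ↔ (∀ i, ContDiffOn ℝ ∞ (fun y => ψ y i) (punctured n)) ∧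
    ∀ x ∈ punctured n, mu ρ (ψ x) = 0 :=
  and_congr_left' contDiffOn_pi

theorem Gamma32_congr (hψ : ψ ∈ Gamma32 ρ) (h : Set.EqOn χ ψ (punctured n)) : χ ∈ Gamma32 ρ :=
  ⟨hψ.1.congr h, fun x hx => by rw [h hx, hψ.2 x hx]⟩

variable [FiniteDimensional ℂ S]

theorem mu_sub (ρ : CliffordRep n S) (v w : Fin (n + 1) → S) :
    mu ρ (fun i => v i - w i) = mu ρ v - mu ρ w := by
  simp only [mu, ← clL_apply, map_sub, Finset.sum_sub_distrib]

/-- Apply `D` to the identity `∑ e_i · ψ_i = 0` and anticommute. -/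
theorem mu_twistedDirac (hψ : ψ ∈ Gamma32 ρ) (hx : x ∈ punctured n) :
    mu ρ (twistedDirac ρ ψ x) = -((2 : ℝ) • divergence ψ x) := by
  obtain ⟨hs, hm⟩ := mem_Gamma32.1 hψ
  have h : dirac ρ (fun y => mu ρ (ψ y)) x = 0 := dirac_eq_zero_of_eqOn hm hx
  unfold mu at h
  rw [dirac_sum _ (fun i _ => smooth_cl _ (hs i)) hx] at h
  simp only [dirac_cl _ (hs _) hx, Finset.sum_sub_distrib, Finset.sum_neg_distrib,
    ← Finset.smul_sum] at h
  change -mu ρ (twistedDirac ρ ψ x) - (2 : ℝ) • divergence ψ x = 0 at h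
  linear_combination (norm := module) -h

theorem raritaSchwinger_eq (hψ : ψ ∈ Gamma32 ρ) (hx : x ∈ punctured n) (i : Fin (n + 1)) :
    raritaSchwinger ρ ψ x i = dirac ρ (fun y => ψ y i) x
      - (2 / ((n : ℝ) + 1)) • cl ρ (e i) (divergence ψ x) := by
  simp only [raritaSchwinger, proj32, mu_twistedDirac hψ hx]
  simp only [twistedDirac, ← clL_apply, map_neg, map_smul]
  module

/-- The product rule adds only `∑ e_i · ψ_i = μ(ψ) = 0`. -/
theorem dirac_contractL (hψ : ψ ∈ Gamma32 ρ) (hx : x ∈ punctured n) :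
    dirac ρ (contractL ψ) x = ∑ i, x i • dirac ρ (fun y => ψ y i) x := by
  obtain ⟨hs, hm⟩ := mem_Gamma32.1 hψ
  unfold contractL
  rw [dirac_sum _ (fun i _ => smooth_coord_smul i (hs i)) hx]
  simp only [dirac_coord_smul _ (hs _) hx, Finset.sum_add_distrib]
  rw [show ∑ i, cl ρ (e i) (ψ x i) = 0 from hm x hx, zero_add]

/-- Membership in `P_k(1)` in terms of components. -/
theorem mem_P1 : ψ ∈ P1 ρ k ↔ ψ ∈ Gamma32 ρ ∧
    (∀ x ∈ punctured n, ∀ i, dirac ρ (fun y => ψ y i) x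
      = (2 / ((n : ℝ) + 1)) • cl ρ (e i) (divergence ψ x)) ∧
    (∀ i, IsPolynomial fun y => ψ y i) ∧ ∀ i, IsHomogeneous k fun y => ψ y i := by
  unfold P1
  rw [Set.mem_ofPred_eq, isPolynomial_pi, isHomogeneous_pi]
  refine and_congr_right fun h => and_congr_left' ?_
  refine forall₂_congr fun x hx => ?_
  rw [funext_iff]
  refine forall_congr' fun i => ?_
  rw [raritaSchwinger_eq h hx, Pi.zero_apply, sub_eq_zero]

theorem Gamma32_sub (hψ : ψ ∈ Gamma32 ρ) (hχ : χ ∈ Gamma32 ρ) :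
    (fun y i => ψ y i - χ y i) ∈ Gamma32 ρ := by
  rw [mem_Gamma32] at *
  exact ⟨fun i => (hψ.1 i).sub (hχ.1 i), fun x hx => by
    rw [mu_sub, hψ.2 x hx, hχ.2 x hx, sub_zero]⟩

theorem P1_sub (hψ : ψ ∈ P1 ρ k) (hχ : χ ∈ P1 ρ k) :
    (fun y i => ψ y i - χ y i) ∈ P1 ρ k := by
  rw [mem_P1] at *
  have h1 := (mem_Gamma32.1 hψ.1).1
  have h2 := (mem_Gamma32.1 hχ.1).1
  refine ⟨Gamma32_sub hψ.1 hχ.1, fun x hx i => ?_, fun i => (hψ.2.2.1 i).sub (hχ.2.2.1 i),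
    fun i => (hψ.2.2.2 i).sub (hχ.2.2.2 i)⟩
  rw [dirac_sub (h1 i) (h2 i) hx, hψ.2.1 x hx, hχ.2.1 x hx, divergence_sub h1 h2 hx]
  simp only [← clL_apply, map_sub, smul_sub]

/-- The divergence of the componentwise equation `Dψ_i = 2/(n+1) e_i · δ` reads `Dδ = 2/(n+1) Dδ`.
-/
theorem dirac_divergence (hn : 2 ≤ n) (hψ : ψ ∈ P1 ρ k) (hx : x ∈ punctured n) :
    dirac ρ (divergence ψ) x = 0 := by
  obtain ⟨hg, hrs, -, -⟩ := mem_P1.1 hψ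
  have hs := (mem_Gamma32.1 hg).1
  have h1 : dirac ρ (divergence ψ) x
      = (2 / ((n : ℝ) + 1)) • dirac ρ (divergence ψ) x := by
    conv_lhs =>
      unfold divergence
      rw [dirac_sum _ (fun i _ => smooth_partialD i (hs i)) hx]
    conv_rhs => rw [dirac, Finset.smul_sum]
    refine Finset.sum_congr rfl fun i _ => ?_
    rw [dirac_partialD i (hs i) hx, partialD_congr i (fun y hy => hrs y hy i) hx]
    exact partialD_clm i ((2 / ((n : ℝ) + 1)) • clL ρ (e i)) (smooth_divergence hs) hx
  -- This factor is nonzero for `n ≥ 2`; it would vanish for `n = 1`.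
  have h2 : (1 - 2 / ((n : ℝ) + 1)) • dirac ρ (divergence ψ) x = 0 := by
    rw [sub_smul, one_smul, ← h1, sub_self]
  refine (smul_eq_zero.1 h2).resolve_left ?_
  have : (2 : ℝ) ≤ n := by exact_mod_cast hn
  have h3 : (n : ℝ) + 1 ≠ 0 := by positivity
  field_simp
  linarith

theorem divergence_mem_P0 (hn : 2 ≤ n) (hψ : ψ ∈ P1 ρ k) : divergence ψ ∈ P0 ρ (k - 1) := by
  obtain ⟨hg, hrs, hp, hh⟩ := mem_P1.1 hψ
  have hs := (mem_Gamma32.1 hg).1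
  exact ⟨⟨smooth_divergence hs, fun x hx => dirac_divergence hn hψ hx⟩,
    IsPolynomial.sum _ fun i _ => (hp i).partialD i,
    IsHomogeneous.sum fun i _ => (hh i).partialD (hs i) i⟩

end Sections

/-! ### Gradients of Dirac solutions and the space `M²` -/

section Pieces

variable {n : ℕ} {S : Type*} [NormedAddCommGroup S] [NormedSpace ℂ S]
  {ρ : CliffordRep n S} {ψ : Space n → Fin (n + 1) → S} {σ φ : Space n → S} {x : Space n}

/-- The multiple `c ∇σ` of the gradient of a spinor field. -/
def scaledGrad (c : ℝ) (σ : Space n → S) (x : Space n) (i : Fin (n + 1)) : S :=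
  c • partialD i σ x

/-- The field `Ξ(φ)` for `φ` in the kernel of the Dirac operator, where the twistor operator is
the gradient. -/
def xiField (ρ : CliffordRep n S) (a : ℝ) (φ : Space n → S) (x : Space n) (j : Fin (n + 1)) : S :=
  a • (‖x‖ ^ 2 • partialD j φ x + ((n : ℝ) + 1) • (x j • φ x) + cl ρ (e j) (cl ρ x (φ x)))

theorem xiField_congr (a : ℝ) {φ' : Space n → S} (h : Set.EqOn φ φ' (punctured n)) :
    Set.EqOn (xiField ρ a φ) (xiField ρ a φ') (punctured n) := fun x hx => by
  funext j
  simp only [xiField, partialD_congr j h hx, h hx]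

variable [FiniteDimensional ℂ S]

/-- The correction made by the projection is a multiple of `e_j · Dσ`. -/
theorem twistor_eq (hσ : σ ∈ kerD ρ) (hx : x ∈ punctured n) (j : Fin (n + 1)) :
    twistor ρ σ x j = partialD j σ x := by
  change partialD j σ x + (1 / ((n : ℝ) + 1)) • cl ρ (e j) (dirac ρ σ x) = _
  rw [hσ.2 x hx, ← clL_apply, map_zero, smul_zero, add_zero]

theorem twistor'_iota_eq (hσ : σ ∈ kerD ρ) :
    Set.EqOn (twistor' ρ fun y => iota ρ (σ y)) (scaledGrad (2 / ((n : ℝ) + 1)) σ)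
      (punctured n) := fun x hx => by
  funext j
  simp only [twistor', mu_iota]
  rw [Pi.smul_apply, twistor_eq hσ hx]
  rfl

theorem scaledGrad_mem_Gamma32 (c : ℝ) (hσ : σ ∈ kerD ρ) : scaledGrad c σ ∈ Gamma32 ρ := by
  refine mem_Gamma32.2 ⟨fun i => (smooth_partialD i hσ.1).const_smul c, fun x hx => ?_⟩
  simp only [mu, scaledGrad, ← clL_apply, map_smul, ← Finset.smul_sum]
  exact (congrArg (c • ·) (hσ.2 x hx)).trans (smul_zero c)

theorem dirac_scaledGrad (c : ℝ) (hσ : σ ∈ kerD ρ) (hx : x ∈ punctured n) (i : Fin (n + 1)) :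
    dirac ρ (fun y => scaledGrad c σ y i) x = 0 := by
  unfold scaledGrad
  rw [dirac_const_smul c (smooth_partialD i hσ.1) hx, dirac_partialD i hσ.1 hx,
    partialD_congr i (g := fun _ => 0) hσ.2 hx]
  simp [partialD]

theorem sum_partialD_partialD_eq_zero (hσ : σ ∈ kerD ρ) (hx : x ∈ punctured n) :
    ∑ i, partialD i (partialD i σ) x = 0 := by
  rw [← neg_eq_zero, ← dirac_dirac (ρ := ρ) hσ.1 hx]
  exact dirac_eq_zero_of_eqOn hσ.2 hx

theorem divergence_scaledGrad (c : ℝ) (hσ : σ ∈ kerD ρ) (hx : x ∈ punctured n) :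
    divergence (scaledGrad c σ) x = 0 := by
  simp only [divergence, scaledGrad]
  rw [Finset.sum_congr rfl fun i _ => partialD_const_smul i c (smooth_partialD i hσ.1) hx,
    ← Finset.smul_sum, sum_partialD_partialD_eq_zero hσ hx, smul_zero]

theorem dirac_contractL_scaledGrad (c : ℝ) (hσ : σ ∈ kerD ρ) (hx : x ∈ punctured n) :
    dirac ρ (contractL (scaledGrad c σ)) x = 0 := by
  rw [dirac_contractL (scaledGrad_mem_Gamma32 c hσ) hx]
  simp only [dirac_scaledGrad c hσ hx, smul_zero, Finset.sum_const_zero]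

theorem scaledGrad_mem_P1 (c : ℝ) {m : ℤ} (hσ : σ ∈ P0 ρ (m + 1)) :
    scaledGrad c σ ∈ P1 ρ m := by
  refine mem_P1.2 ⟨scaledGrad_mem_Gamma32 c hσ.1, fun x hx i => ?_,
    fun i => (hσ.2.1.partialD i).const_smul c, fun i => ?_⟩
  · rw [dirac_scaledGrad c hσ.1 hx, divergence_scaledGrad c hσ.1 hx, ← clL_apply, map_zero,
      smul_zero]
  · have := (hσ.2.2.partialD hσ.1.1 i).const_smul c
    rwa [add_sub_cancel_right] at this

theorem scaledGrad_mem_M2 (c : ℝ) (hσ : σ ∈ kerD ρ) : scaledGrad c σ ∈ M2 ρ := by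
  -- The factor `(n+1)/2` cancels the normalization `2/(n+1)` of `T'`.
  have h : (fun y => (((n : ℝ) + 1) / 2 * c) • σ y) ∈ kerD ρ :=
    ⟨hσ.1.const_smul _, fun x hx => by
      rw [dirac_const_smul _ hσ.1 hx, hσ.2 x hx, smul_zero]⟩
  refine ⟨_, h, fun x hx => ?_⟩
  rw [twistor'_iota_eq h hx]
  funext i
  simp only [scaledGrad]
  rw [partialD_const_smul i _ hσ.1 hx, smul_smul]
  congr 1
  have : (n : ℝ) + 1 ≠ 0 := by positivity
  field_simp

theorem exists_scaledGrad_of_mem_M2 (h : ψ ∈ M2 ρ) :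
    ∃ σ ∈ kerD ρ, Set.EqOn ψ (scaledGrad (2 / ((n : ℝ) + 1)) σ) (punctured n) := by
  obtain ⟨σ, hσ, hψ⟩ := h
  exact ⟨σ, hσ, hψ.trans (twistor'_iota_eq hσ)⟩

theorem M2_sub {χ : Space n → Fin (n + 1) → S} (hψ : ψ ∈ M2 ρ) (hχ : χ ∈ M2 ρ) :
    (fun y i => ψ y i - χ y i) ∈ M2 ρ := by
  obtain ⟨σ, hσ, h1⟩ := exists_scaledGrad_of_mem_M2 hψ
  obtain ⟨τ, hτ, h2⟩ := exists_scaledGrad_of_mem_M2 hχ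
  have h : (fun y => σ y - τ y) ∈ kerD ρ := ⟨hσ.1.sub hτ.1, fun x hx => by
    rw [dirac_sub hσ.1 hτ.1 hx, hσ.2 x hx, hτ.2 x hx, sub_zero]⟩
  refine ⟨_, h, fun x hx => ?_⟩
  rw [twistor'_iota_eq h hx]
  funext i
  simp only [h1 hx, h2 hx, scaledGrad]
  rw [partialD_sub i hσ.1 hτ.1 hx, smul_sub]

/-- A homogeneous element of `M²` of degree other than `-1` that is annihilated by `L`
vanishes. -/
theorem eq_zero_of_mem_M2 {m : ℤ} (hm : m ≠ -1) (hψ : ψ ∈ M2 ρ) (hh : IsHomogeneous m ψ)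
    (hL : ∀ x ∈ punctured n, contractL ψ x = 0) (hx : x ∈ punctured n) : ψ x = 0 := by
  obtain ⟨σ, hσ, h⟩ := exists_scaledGrad_of_mem_M2 hψ
  have hc : 2 / ((n : ℝ) + 1) ≠ 0 := by positivity
  have hs := (mem_Gamma32.1 (scaledGrad_mem_Gamma32 (2 / ((n : ℝ) + 1)) hσ)).1
  -- Vanishing of `L` says that `σ` is constant along rays.
  have hE : ∀ y ∈ punctured n, ∑ i, y i • partialD i σ y = 0 := fun y hy => by
    have h1 := hL y hy
    rw [contractL_congr h hy] at h1
    simp only [contractL, scaledGrad, smul_comm _ (2 / ((n : ℝ) + 1)), ← Finset.smul_sum] at h1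
    exact (smul_eq_zero.1 h1).resolve_left hc
  rw [h hx]
  funext j
  -- Differentiating this relation shows that `∂_jσ` is an Euler eigenfunction of eigenvalue `-1`.
  have h2 : (∑ i, x i • partialD i (partialD j σ) x) + partialD j σ x = 0 := by
    have h3 : partialD j (fun y => ∑ i, y i • partialD i σ y) x = 0 := by
      rw [partialD_congr j (g := fun _ => 0) hE hx]
      simp [partialD]
    rw [partialD_sum _ j (fun i _ => smooth_coord_smul i (smooth_partialD i hσ.1)) hx] at h3
    simp only [partialD_coord_smul j _ (smooth_partialD _ hσ.1) hx, Finset.sum_add_distrib,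
      Finset.sum_ite_eq, Finset.mem_univ, if_true, partialD_comm j _ hσ.1 hx] at h3
    rw [add_comm, h3]
  -- The potential `σ` need not be homogeneous, so Euler's identity is applied to `∂_jσ`, a multiple
  -- of `ψ_j`; the eigenvalue is now `m ≠ -1`.
  have h4 : ∑ i, x i • partialD i (partialD j σ) x = (m : ℝ) • partialD j σ x := by
    have hj : IsHomogeneous m (partialD j σ) := by
      refine ((isHomogeneous_pi.1 (hh.congr h.symm) j).const_smul
        (2 / ((n : ℝ) + 1))⁻¹).congr fun y _ => ?_
      simp only [scaledGrad]
      rw [inv_smul_smul₀ hc]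
    exact hj.euler (smooth_partialD j hσ.1) hx
  have h5 : ((m : ℝ) + 1) • partialD j σ x = 0 := by
    rw [add_smul, one_smul, ← h4, h2]
  have h6 : (m : ℝ) + 1 ≠ 0 := by
    intro h
    exact hm (by exact_mod_cast eq_neg_of_add_eq_zero_left h)
  simp only [scaledGrad, (smul_eq_zero.1 h5).resolve_left h6, smul_zero, Pi.zero_apply]

/-! ### The fields `Ξ(φ)` and the space `M³` -/

theorem Xi_eqOn (k : ℕ) (hφ : φ ∈ kerD ρ) :
    Set.EqOn (Xi ρ k φ) (xiField ρ (1 / (2 * ((n : ℝ) + (k : ℝ) - 1))) φ) (punctured n) :=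
  fun x hx => by
    funext j
    simp only [Xi, xiField, twistor_eq hφ hx, smul_smul]

theorem xiField_mem_Gamma32 (a : ℝ) (hφ : φ ∈ kerD ρ) : xiField ρ a φ ∈ Gamma32 ρ := by
  refine mem_Gamma32.2 ⟨fun i => (((smooth_normSq_smul (smooth_partialD i hφ.1)).add
    ((smooth_coord_smul i hφ.1).const_smul _)).add
      (smooth_cl _ (smooth_cl_pos hφ.1))).const_smul a, fun x hx => ?_⟩
  simp only [mu, xiField, ← clL_apply, map_smul, map_add, ← Finset.smul_sum,
    Finset.sum_add_distrib]
  simp only [clL_apply, cl_cl, ← cl_eq_sum]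
  rw [show ∑ i, cl ρ (e i) (partialD i φ x) = 0 from hφ.2 x hx]
  simp only [e, PiLp.norm_single, norm_one, one_pow, Finset.sum_const, Finset.card_univ,
    Fintype.card_fin, ← Nat.cast_smul_eq_nsmul ℝ]
  push_cast
  module

theorem dirac_cl_pos_of_mem {m : ℤ} (hφ : φ ∈ P0 ρ m) (hx : x ∈ punctured n) :
    dirac ρ (fun y => cl ρ y (φ y)) x = -((n : ℝ) + 1 + 2 * m) • φ x := by
  rw [dirac_cl_pos hφ.1.1 hx, hφ.2.2.euler hφ.1.1 hx, hφ.1.2 x hx, ← clL_apply, map_zero]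
  module

/-- Since `e_j` is constant, this divergence is `D(x · φ)`. -/
theorem sum_smul_partialD_cl_pos {m : ℤ} (hφ : φ ∈ P0 ρ m) (hx : x ∈ punctured n) :
    divergence (fun y j => cl ρ (e j) (cl ρ y (φ y))) x = -((n : ℝ) + 1 + 2 * m) • φ x := by
  rw [← dirac_cl_pos_of_mem hφ hx]
  exact Finset.sum_congr rfl fun i _ =>
    partialD_clm i (clL ρ (e i)) (smooth_cl_pos hφ.1.1) hx

/-- As `φ` is harmonic of degree `m`, the three terms contribute `2m`, `(n+1)(n+1+m)` and
`-(n+1+2m)`, with sum `(n+1)(n+m)`. -/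
theorem divergence_xiField (a : ℝ) {m : ℤ} (hφ : φ ∈ P0 ρ m) (hx : x ∈ punctured n) :
    divergence (xiField ρ a φ) x = (a * (((n : ℝ) + 1) * (n + m))) • φ x := by
  have h1 := hφ.2.2.euler hφ.1.1 hx
  have hs : ∀ i, ContDiffOn ℝ ∞ (fun y => ‖y‖ ^ 2 • partialD i φ y) (punctured n) :=
    fun i => smooth_normSq_smul (smooth_partialD i hφ.1.1)
  have hs' : ∀ i : Fin (n + 1), ContDiffOn ℝ ∞ (fun y : Space n => ((n : ℝ) + 1) • (y i • φ y))
      (punctured n) := fun i => (smooth_coord_smul i hφ.1.1).const_smul _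
  have hs'' : ∀ i : Fin (n + 1), ContDiffOn ℝ ∞ (fun y => cl ρ (e i) (cl ρ y (φ y)))
      (punctured n) := fun i => smooth_cl _ (smooth_cl_pos hφ.1.1)
  have h2 : ∀ i, partialD i (fun y => xiField ρ a φ y i) x
      = a • ((2 : ℝ) • (x i • partialD i φ x) + ‖x‖ ^ 2 • partialD i (partialD i φ) x
        + ((n : ℝ) + 1) • (φ x + x i • partialD i φ x)
        + partialD i (fun y => cl ρ (e i) (cl ρ y (φ y))) x) := fun i => by
    unfold xiField
    rw [partialD_const_smul i a (((hs i).add (hs' i)).add (hs'' i)) hx,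
      partialD_add i ((hs i).add (hs' i)) (hs'' i) hx, partialD_add i (hs i) (hs' i) hx,
      partialD_normSq_smul i (smooth_partialD i hφ.1.1) hx,
      partialD_const_smul i _ (smooth_coord_smul i hφ.1.1) hx,
      partialD_coord_smul i i hφ.1.1 hx, if_pos rfl, smul_smul 2]
  unfold divergence
  simp only [h2, ← Finset.smul_sum, Finset.sum_add_distrib]
  rw [h1, sum_partialD_partialD_eq_zero hφ.1 hx]
  rw [show ∑ i, partialD i (fun y => cl ρ (e i) (cl ρ y (φ y))) x = _ from
    sum_smul_partialD_cl_pos hφ hx]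
  simp only [Finset.sum_const, Finset.card_univ, Fintype.card_fin, ← Nat.cast_smul_eq_nsmul ℝ]
  push_cast
  module

/-- The term `2x · ∂_jφ` from `‖x‖²∂_jφ` cancels against the one from `e_j · (x · φ)`; the multiples
of `e_j · φ` add up to `(n+1) + (n+1+2m) - 2`. -/
theorem dirac_xiField (a : ℝ) {m : ℤ} (hφ : φ ∈ P0 ρ m) (hx : x ∈ punctured n)
    (j : Fin (n + 1)) :
    dirac ρ (fun y => xiField ρ a φ y j) x = (a * (2 * (n + m))) • cl ρ (e j) (φ x) := by
  have hs := smooth_normSq_smul (smooth_partialD j hφ.1.1)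
  have hs' : ContDiffOn ℝ ∞ (fun y : Space n => ((n : ℝ) + 1) • (y j • φ y))
      (punctured n) := (smooth_coord_smul j hφ.1.1).const_smul _
  have hp := smooth_cl_pos (ρ := ρ) hφ.1.1
  have hs'' := smooth_cl (ρ := ρ) (e j) hp
  have h1 : partialD j (fun y => cl ρ y (φ y)) x
      = cl ρ (e j) (φ x) + cl ρ x (partialD j φ x) := by
    rw [show (fun y => cl ρ y (φ y)) = fun y => ∑ i, y i • cl ρ (e i) (φ y) from
      funext fun y => cl_eq_sum ρ y (φ y),
      partialD_sum _ j (fun i _ => smooth_coord_smul i (smooth_cl _ hφ.1.1)) hx]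
    simp only [partialD_coord_smul j _ (smooth_cl _ hφ.1.1) hx, Finset.sum_add_distrib,
      Finset.sum_ite_eq, Finset.mem_univ, if_true]
    rw [cl_eq_sum ρ x]
    congr 1
    exact Finset.sum_congr rfl fun i _ =>
      congrArg (x i • ·) (partialD_clm j (clL ρ (e i)) hφ.1.1 hx)
  have h0 : dirac ρ (partialD j φ) x = 0 := by
    have := dirac_scaledGrad 1 hφ.1 hx j
    simpa only [scaledGrad, one_smul] using this
  unfold xiField
  rw [dirac_const_smul a ((hs.add hs').add hs'') hx, dirac_add (hs.add hs') hs'' hx,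
    dirac_add hs hs' hx, dirac_normSq_smul (smooth_partialD j hφ.1.1) hx,
    dirac_const_smul _ (smooth_coord_smul j hφ.1.1) hx, dirac_coord_smul j hφ.1.1 hx,
    dirac_cl j hp hx, dirac_cl_pos_of_mem hφ hx, h1, h0, hφ.1.2 x hx, ← clL_apply ρ (e j) (_ • _),
    map_smul, clL_apply]
  module

theorem normalization_ne_zero (hn : 2 ≤ n) (k : ℕ) : 2 * ((n : ℝ) + (k : ℝ) - 1) ≠ 0 := by
  have h1 : (2 : ℝ) ≤ n := by exact_mod_cast hn
  have h2 : (0 : ℝ) ≤ k := k.cast_nonneg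
  exact ne_of_gt (by linarith)

theorem divergence_xiField_normalized (hn : 2 ≤ n) (k : ℕ) (hφ : φ ∈ P0 ρ ((k : ℤ) - 1))
    (hx : x ∈ punctured n) :
    divergence (xiField ρ (1 / (2 * ((n : ℝ) + (k : ℝ) - 1))) φ) x
      = (((n : ℝ) + 1) / 2) • φ x := by
  rw [divergence_xiField _ hφ hx]
  congr 1
  have := right_ne_zero_of_mul (normalization_ne_zero hn k)
  push_cast
  rw [← add_sub_assoc]
  field_simp

theorem dirac_xiField_normalized (hn : 2 ≤ n) (k : ℕ) (hφ : φ ∈ P0 ρ ((k : ℤ) - 1))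
    (hx : x ∈ punctured n) (j : Fin (n + 1)) :
    dirac ρ (fun y => xiField ρ (1 / (2 * ((n : ℝ) + (k : ℝ) - 1))) φ y j) x
      = cl ρ (e j) (φ x) := by
  rw [dirac_xiField _ hφ hx]
  have := normalization_ne_zero hn k
  push_cast
  rw [← add_sub_assoc, one_div_mul_cancel this, one_smul]

/-- The equation holds because `Dψ_i = e_i · φ` while the divergence is `(n+1)/2 φ`, exactly the
required ratio. -/
theorem xiField_mem_P1 (hn : 2 ≤ n) (k : ℕ) (hφ : φ ∈ P0 ρ ((k : ℤ) - 1)) :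
    xiField ρ (1 / (2 * ((n : ℝ) + (k : ℝ) - 1))) φ ∈ P1 ρ k := by
  refine mem_P1.2 ⟨xiField_mem_Gamma32 _ hφ.1, fun x hx i => ?_, fun i => ?_, fun i => ?_⟩
  · rw [dirac_xiField_normalized hn k hφ hx, divergence_xiField_normalized hn k hφ hx,
      ← clL_apply, ← clL_apply, map_smul, smul_smul]
    have : (n : ℝ) + 1 ≠ 0 := by positivity
    rw [show 2 / ((n : ℝ) + 1) * (((n : ℝ) + 1) / 2) = 1 by field_simp, one_smul]
  · have hp : IsPolynomial fun y => cl ρ y (φ y) :=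
      (IsPolynomial.sum Finset.univ fun i _ =>
        (hφ.2.1.clm (clL ρ (e i))).coord_smul i).congr fun y _ => cl_eq_sum ρ y (φ y)
    exact ((((hφ.2.1.partialD i).normSq_smul).add ((hφ.2.1.coord_smul i).const_smul _)).add
      (hp.clm (clL ρ (e i)))).const_smul _
  · have h1 : IsHomogeneous k fun y => cl ρ y (φ y) := by
      refine (IsHomogeneous.sum (s := Finset.univ) fun i _ => ?_).congr
        fun y _ => cl_eq_sum ρ y (φ y)
      have := (hφ.2.2.clm (clL ρ (e i))).coord_smul i
      rwa [sub_add_cancel] at this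
    have h2 := (hφ.2.2.partialD hφ.1.1 i).normSq_smul
    have h3 := hφ.2.2.coord_smul i
    rw [show (k : ℤ) - 1 - 1 + 2 = k by ring] at h2
    rw [sub_add_cancel] at h3
    exact ((h2.add (h3.const_smul _)).add (h1.clm (clL ρ (e i)))).const_smul _

theorem dirac_contractL_xiField (hn : 2 ≤ n) (k : ℕ) (hφ : φ ∈ P0 ρ ((k : ℤ) - 1))
    (hx : x ∈ punctured n) :
    dirac ρ (contractL (xiField ρ (1 / (2 * ((n : ℝ) + (k : ℝ) - 1))) φ)) x
      = cl ρ x (φ x) := by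
  rw [dirac_contractL (xiField_mem_Gamma32 _ hφ.1) hx, cl_eq_sum]
  simp only [dirac_xiField_normalized hn k hφ hx]

/-! ### The inclusions for `M²` and `M³`, and the decomposition -/

theorem M2_subset : M2 ρ ⊆
    {ψ | ψ ∈ Gamma32 ρ ∧ ∀ x ∈ punctured n, dirac ρ (contractL ψ) x = 0} := fun ψ hψ => by
  obtain ⟨σ, hσ, h⟩ := exists_scaledGrad_of_mem_M2 hψ
  refine ⟨Gamma32_congr (scaledGrad_mem_Gamma32 _ hσ) h, fun x hx => ?_⟩
  rw [dirac_congr (contractL_congr h) hx, dirac_contractL_scaledGrad _ hσ hx]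

theorem M3_mem_Gamma32 {k : ℕ} (hψ : ψ ∈ M3 ρ k) : ψ ∈ Gamma32 ρ := by
  obtain ⟨φ, hφ, h⟩ := hψ
  exact Gamma32_congr (xiField_mem_Gamma32 _ hφ.1) (h.trans (Xi_eqOn k hφ.1))

/-- An element of `M³` is determined by the spinor field `D L(ψ)`. -/
theorem exists_dirac_contractL_of_mem_M3 (hn : 2 ≤ n) {k : ℕ} (hψ : ψ ∈ M3 ρ k) :
    ∃ φ ∈ P0 ρ ((k : ℤ) - 1),
      Set.EqOn ψ (xiField ρ (1 / (2 * ((n : ℝ) + (k : ℝ) - 1))) φ) (punctured n) ∧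
      ∀ x ∈ punctured n, dirac ρ (contractL ψ) x = cl ρ x (φ x) := by
  obtain ⟨φ, hφ, h⟩ := hψ
  have h' := h.trans (Xi_eqOn k hφ.1)
  exact ⟨φ, hφ, h', fun x hx => by
    rw [dirac_congr (contractL_congr h') hx, dirac_contractL_xiField hn k hφ hx]⟩

/-- `D L` recovers `x · φ`, and Clifford multiplication by `x ≠ 0` is injective. -/
theorem eqOn_of_mem_M3 (hn : 2 ≤ n) {k : ℕ} {χ : Space n → Fin (n + 1) → S}
    (hψ : ψ ∈ M3 ρ k) (hχ : χ ∈ M3 ρ k)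
    (h : ∀ x ∈ punctured n, dirac ρ (contractL ψ) x = dirac ρ (contractL χ) x) :
    Set.EqOn ψ χ (punctured n) := by
  obtain ⟨φ, -, h1, h2⟩ := exists_dirac_contractL_of_mem_M3 hn hψ
  obtain ⟨φ', -, h1', h2'⟩ := exists_dirac_contractL_of_mem_M3 hn hχ
  have hφ : Set.EqOn φ φ' (punctured n) := fun x hx => by
    have := h x hx
    rw [h2 x hx, h2' x hx, ← sub_eq_zero, ← clL_apply, ← clL_apply, ← map_sub] at this
    exact sub_eq_zero.1 (cl_eq_zero hx this)
  exact (h1.trans (xiField_congr _ hφ)).trans h1'.symm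

theorem zero_mem_M3 (k : ℕ) : (fun _ _ => 0) ∈ M3 ρ k := by
  have h0 : (fun _ => 0) ∈ P0 ρ ((k : ℤ) - 1) :=
    ⟨⟨contDiffOn_const, fun x hx => dirac_eq_zero_of_eqOn (fun _ _ => rfl) hx⟩,
      isPolynomial_const 0, fun t _ x _ => by simp⟩
  refine ⟨_, h0, fun x hx => ?_⟩
  rw [Xi_eqOn k h0.1 hx]
  funext j
  simp [xiField, partialD, ← clL_apply]

theorem M3_subset (hn : 2 ≤ n) (k : ℕ) : M3 ρ k ⊆
    {ψ | ψ ∈ Gamma32 ρ ∧ ((∃ x ∈ punctured n, ψ x ≠ 0) →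
      ∃ x ∈ punctured n, dirac ρ (contractL ψ) x ≠ 0)} := fun ψ hψ => by
  refine ⟨M3_mem_Gamma32 hψ, ?_⟩
  contrapose!
  intro h x hx
  refine eqOn_of_mem_M3 hn hψ (zero_mem_M3 k) (fun y hy => ?_) hx
  rw [h y hy, dirac_eq_zero_of_eqOn (fun z _ => by simp [contractL]) hy]

theorem exists_decomposition (hn : 2 ≤ n) (k : ℕ) (hψ : ψ ∈ P1 ρ k) :
    ∃ ψ₁ ∈ P1 ρ k ∩ M1 ρ, ∃ ψ₂ ∈ P1 ρ k ∩ M2 ρ, ∃ ψ₃ ∈ P1 ρ k ∩ M3 ρ k,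
      Set.EqOn ψ (ψ₁ + ψ₂ + ψ₃) (punctured n) := by
  have hδ := divergence_mem_P0 hn hψ
  have hN : (n : ℝ) + 1 ≠ 0 := by positivity
  -- `2/(n+1)` inverts the factor in `divergence_xiField_normalized`, so `ψ₃` will carry the whole
  -- divergence of `ψ`.
  have hφ : (fun y => (2 / ((n : ℝ) + 1)) • divergence ψ y) ∈ P0 ρ ((k : ℤ) - 1) :=
    ⟨⟨hδ.1.1.const_smul _, fun x hx => by
      rw [dirac_const_smul _ hδ.1.1 hx, hδ.1.2 x hx, smul_zero]⟩,
      hδ.2.1.const_smul _, hδ.2.2.const_smul _⟩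
  set ψ₃ := xiField ρ (1 / (2 * ((n : ℝ) + (k : ℝ) - 1)))
    (fun y => (2 / ((n : ℝ) + 1)) • divergence ψ y) with hψ₃
  have h3 : ψ₃ ∈ P1 ρ k := xiField_mem_P1 hn k hφ
  have h' := P1_sub hψ h3
  have hdiv : ∀ x ∈ punctured n, divergence (fun y i => ψ y i - ψ₃ y i) x = 0 := fun x hx => by
    rw [divergence_sub (mem_Gamma32.1 hψ.1).1 (mem_Gamma32.1 h3.1).1 hx,
      divergence_xiField_normalized hn k hφ hx, smul_smul,
      show ((n : ℝ) + 1) / 2 * (2 / ((n : ℝ) + 1)) = 1 by field_simp, one_smul, sub_self]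
  obtain ⟨hg, hrs, hp, hh⟩ := mem_P1.1 h'
  set σ := contractL fun y i => ψ y i - ψ₃ y i with hσ
  have hσ0 : σ ∈ P0 ρ ((k : ℤ) + 1) := by
    refine ⟨⟨smooth_contractL (mem_Gamma32.1 hg).1, fun x hx => ?_⟩,
      IsPolynomial.sum _ fun i _ => (hp i).coord_smul i,
      IsHomogeneous.sum fun i _ => (hh i).coord_smul i⟩
    rw [hσ, dirac_contractL hg hx]
    refine Finset.sum_eq_zero fun i _ => ?_
    rw [hrs x hx i, hdiv x hx, ← clL_apply, map_zero, smul_zero, smul_zero]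
  -- `σ` has degree `k + 1`, so by Euler's identity this multiple of its gradient contracts back to
  -- `σ`.
  have h2 := scaledGrad_mem_P1 (1 / ((k : ℝ) + 1)) hσ0
  have h1 := P1_sub h' h2
  refine ⟨_, ⟨h1, h1.1, fun x hx => ?_⟩, _, ⟨h2, scaledGrad_mem_M2 _ hσ0.1⟩, _,
    ⟨h3, _, hφ, (Xi_eqOn k hφ.1).symm⟩, fun x _ => ?_⟩
  · rw [contractL_sub, ← hσ, sub_eq_zero]
    simp only [contractL, scaledGrad, smul_comm _ (1 / ((k : ℝ) + 1)), ← Finset.smul_sum]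
    rw [hσ0.2.2.euler hσ0.1.1 hx, smul_smul]
    push_cast
    have : (k : ℝ) + 1 ≠ 0 := by positivity
    rw [one_div_mul_cancel this, one_smul]
  · funext i
    simp

/-- Peel off the pieces in reverse: `L` removes `M¹`, then `D` removes `M²` and pins down the third
piece; the difference of the second pieces is then killed by `L`. -/
theorem decomposition_unique (hn : 2 ≤ n) (k : ℕ)
    {ψ₁ ψ₂ ψ₃ χ₁ χ₂ χ₃ : Space n → Fin (n + 1) → S}
    (h₁ : ψ₁ ∈ M1 ρ) (h₂ : ψ₂ ∈ M2 ρ) (h₃ : ψ₃ ∈ M3 ρ k)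
    (g₁ : χ₁ ∈ M1 ρ) (g₂ : χ₂ ∈ M2 ρ) (g₃ : χ₃ ∈ M3 ρ k)
    (hh : IsHomogeneous k ψ₂) (gh : IsHomogeneous k χ₂)
    (h : Set.EqOn (ψ₁ + ψ₂ + ψ₃) (χ₁ + χ₂ + χ₃) (punctured n)) :
    Set.EqOn ψ₁ χ₁ (punctured n) ∧ Set.EqOn ψ₂ χ₂ (punctured n) ∧
      Set.EqOn ψ₃ χ₃ (punctured n) := by
  have hadd : ∀ α β : Space n → Fin (n + 1) → S, ∀ x,
      contractL (α + β) x = contractL α x + contractL β x := fun α β x => by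
    simp [contractL, Finset.sum_add_distrib]
  have hL : Set.EqOn (fun y => contractL ψ₂ y + contractL ψ₃ y)
      (fun y => contractL χ₂ y + contractL χ₃ y) (punctured n) := fun x hx => by
    have := contractL_congr h hx
    rw [hadd, hadd, hadd, hadd, h₁.2 x hx, g₁.2 x hx, zero_add, zero_add] at this
    exact this
  have hs : ∀ {α : Space n → Fin (n + 1) → S}, α ∈ Gamma32 ρ →
      ContDiffOn ℝ ∞ (contractL α) (punctured n) :=
    fun hα => smooth_contractL (mem_Gamma32.1 hα).1
  have e3 : Set.EqOn ψ₃ χ₃ (punctured n) := by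
    refine eqOn_of_mem_M3 hn h₃ g₃ fun x hx => ?_
    have := dirac_congr (ρ := ρ) hL hx
    rwa [dirac_add (hs (M2_subset h₂).1) (hs (M3_mem_Gamma32 h₃)) hx,
      dirac_add (hs (M2_subset g₂).1) (hs (M3_mem_Gamma32 g₃)) hx,
      (M2_subset h₂).2 x hx, (M2_subset g₂).2 x hx, zero_add, zero_add] at this
  have e2 : Set.EqOn ψ₂ χ₂ (punctured n) := fun x hx => by
    -- The degree `k` is a natural number, hence not the exceptional `-1`.
    have := eq_zero_of_mem_M2 (m := k) (by omega) (M2_sub h₂ g₂) (hh.sub gh) (fun y hy => by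
      have := hL hy
      simp only [contractL_congr e3 hy] at this
      rw [contractL_sub, add_right_cancel this, sub_self]) hx
    exact sub_eq_zero.1 this
  refine ⟨fun x hx => ?_, e2, e3⟩
  have := h hx
  simp only [Pi.add_apply, e2 hx, e3 hx] at this
  exact add_right_cancel (add_right_cancel this)

end Pieces

end RaritaSchwinger

end

theorem mainTheorem5 (n : ℕ) (hn : 2 ≤ n)
    (S : Type*) [NormedAddCommGroup S] [NormedSpace ℂ S] [FiniteDimensional ℂ S]
    (ρ : CliffordRep n S) (hρ : IsSpinorModule ρ) (k : ℕ) :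
    -- existence of the decomposition, with pieces that are again `k`-homogeneous solutions
    (∀ ψ ∈ P1 ρ k,
      (∃ ψ₁ ∈ P1 ρ k ∩ M1 ρ, ∃ ψ₂ ∈ P1 ρ k ∩ M2 ρ, ∃ ψ₃ ∈ P1 ρ k ∩ M3 ρ k,
        Set.EqOn ψ (ψ₁ + ψ₂ + ψ₃) (punctured n)) ∧
      -- uniqueness among all decompositions into `k`-homogeneous pieces
      (∀ ψ₁ ∈ M1 ρ, ∀ ψ₂ ∈ M2 ρ, ∀ ψ₃ ∈ M3 ρ k, ∀ χ₁ ∈ M1 ρ, ∀ χ₂ ∈ M2 ρ, ∀ χ₃ ∈ M3 ρ k,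
        IsHomogeneous k ψ₁ → IsHomogeneous k ψ₂ → IsHomogeneous k ψ₃ →
        IsHomogeneous k χ₁ → IsHomogeneous k χ₂ → IsHomogeneous k χ₃ →
        Set.EqOn ψ (ψ₁ + ψ₂ + ψ₃) (punctured n) → Set.EqOn ψ (χ₁ + χ₂ + χ₃) (punctured n) →
        Set.EqOn ψ₁ χ₁ (punctured n) ∧ Set.EqOn ψ₂ χ₂ (punctured n) ∧
          Set.EqOn ψ₃ χ₃ (punctured n))) ∧
    -- the inclusion for `M²`
    M2 ρ ⊆ {ψ | ψ ∈ Gamma32 ρ ∧ ∀ x ∈ punctured n, dirac ρ (contractL ψ) x = 0} ∧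
    -- the inclusion for `M³`
    M3 ρ k ⊆ {ψ | ψ ∈ Gamma32 ρ ∧ ((∃ x ∈ punctured n, ψ x ≠ 0) →
      ∃ x ∈ punctured n, dirac ρ (contractL ψ) x ≠ 0)} :=
  ⟨fun _ hψ => ⟨exists_decomposition hn k hψ,
    fun _ h₁ _ h₂ _ h₃ _ g₁ _ g₂ _ g₃ _ hh _ _ gh _ h g =>
      decomposition_unique hn k h₁ h₂ h₃ g₁ g₂ g₃ hh gh (h.symm.trans g)⟩,
    M2_subset, M3_subset hn k⟩
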